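/- Let $m\ge 3$ be odd, let $q=3^m$ and $n=q-1$, and let $\alpha$ be a generator of the multiplicative group $\mathrm{GF}(q)^*$. For an integer $a\ge 0$ let $\mathtt{C}_a=\{a\,3^j \bmod n : j\ge 0\}$ be the $3$-cyclotomic coset of $a$ modulo $n$ and let $\ell_a=|\mathtt{C}_a|$. For integers $u,v\ge 0$ let $\mathcal{C}_{(u,v,3,m)}\subseteq \mathrm{GF}(3)^n$ be the set of the words $\mathbf{c}(a,b)=(c_0,\dots,c_{n-1})$, $$c_i=\mathrm{Tr}_1^{\ell_u}(a\alpha^{iu})+\mathrm{Tr}_1^{\ell_v}(b\alpha^{iv}),\qquad 0\le i\le n-1,$$ with $(a,b)\in \mathrm{GF}(3^{\ell_u})\times\mathrm{GF}(3^{\ell_v})$, where $\mathrm{Tr}_1^{\ell}$ denotes the trace from $\mathrm{GF}(3^\ell)$ to $\mathrm{GF}(3)$. (The code depends only on $u$ and $v$ modulo $n$.) Suppose that one of the following holds: 1. $v=\dfrac{3^{m+1}-1}{3^h+1}+\dfrac{3^m-1}{2}$, where $h$ is a positive integer dividing $m+1$ such that $(m+1)/h$ is even; 2. $v=(3^{(m+1)/8}-1)(3^{(m+1)/4}+1)(3^{(m+1)/2}+1)+\dfrac{3^m-1}{2}$,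 where $m\equiv 7\pmod 8$; 3. $v=(3^{(m+1)/4}-1)(3^{(m+1)/2}+1)+\dfrac{3^m-1}{2}$, where $m\equiv 3\pmod 4$. Then $\mathtt{C}_1\cap\mathtt{C}_v=\emptyset$, $\ell_1=\ell_v=m$, and $\mathcal{C}_{(1,v,3,m)}$ is a cyclic code over $\mathrm{GF}(3)$ of length $3^m-1$ and dimension $2m$. The number $A_w$ of its codewords of Hamming weight $w$ is - $A_0=1$, - $A_w=\frac12(3^m-1)\left(3^{m-1}+3^{(m-1)/2}\right)$ for $w=2\left(3^{m-1}-3^{(m-1)/2}\right)$, - $A_w=(3^m-1)\left(3^m-3^{m-1}+1\right)$ for $w=2\cdot 3^{m-1}$, - $A_w=\frac12(3^m-1)\left(3^{m-1}-3^{(m-1)/2}\right)$ for $w=2\left(3^{m-1}+3^{(m-1)/2}\right)$, and $A_w=0$ for every other $w$. -/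

import Mathlib

open scoped IntermediateField

/-- The `p`-cyclotomic coset modulo `n` containing `a`, as a set of residue classes modulo `n`. -/
def cyclotomicCoset (p n a : ℕ) : Set (ZMod n) :=
  {x | ∃ j : ℕ, x = (a : ZMod n) * (p : ZMod n) ^ j}

/-- The linear map sending `(a, b)` to the word `(c_0, …, c_{n-1})`, `n = p ^ m - 1`, with
`c_i = Tr (a α^{iu}) + Tr (b α^{iv})`. Here `a` and the powers of `α^u` lie in the subfield
`GF(p)(α^u)` of `K`, which is the field with `p ^ ℓ_u` elements, `ℓ_u` being the size of the
`p`-cyclotomic coset of `u` (proved in `finrank_adjoin_pow` below), and the trace is the one from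
that subfield to `GF(p)`; likewise for `b` and `v`. -/
noncomputable def codewordMap (u v p m : ℕ) [Fact p.Prime] {K : Type*} [Field K]
    [Algebra (ZMod p) K] (α : Kˣ) :
    ((ZMod p)⟮(α : K) ^ u⟯ × (ZMod p)⟮(α : K) ^ v⟯) →ₗ[ZMod p] (Fin (p ^ m - 1) → ZMod p) :=
  LinearMap.pi fun i =>
    LinearMap.coprod
      (Algebra.trace (ZMod p) (ZMod p)⟮(α : K) ^ u⟯ ∘ₗ
        LinearMap.mulRight (ZMod p)
          (IntermediateField.AdjoinSimple.gen (ZMod p) ((α : K) ^ u) ^ (i : ℕ)))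
      (Algebra.trace (ZMod p) (ZMod p)⟮(α : K) ^ v⟯ ∘ₗ
        LinearMap.mulRight (ZMod p)
          (IntermediateField.AdjoinSimple.gen (ZMod p) ((α : K) ^ v) ^ (i : ℕ)))

/-- The code `C_(u,v,p,m)` of length `p ^ m - 1` over `GF(p)`, for a generator `α` of the
multiplicative group of a field `K` with `p ^ m` elements. -/
noncomputable def cyclicCode (u v p m : ℕ) [Fact p.Prime] {K : Type*} [Field K]
    [Algebra (ZMod p) K] (α : Kˣ) : Submodule (ZMod p) (Fin (p ^ m - 1) → ZMod p) :=
  LinearMap.range (codewordMap u v p m α)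

/-- A linear code is cyclic if `(c_{n-1}, c_0, …, c_{n-2})` is a codeword whenever
`(c_0, c_1, …, c_{n-1})` is one. -/
def IsCyclicCode {F : Type*} [Field F] {n : ℕ} (C : Submodule F (Fin n → F)) : Prop :=
  ∀ c ∈ C, (fun i => c ((finRotate n).symm i)) ∈ C

/-- The number `A_w` of codewords of Hamming weight `w`. -/
noncomputable def weightCount {F : Type*} [Field F] [DecidableEq F] {n : ℕ}
    (C : Submodule F (Fin n → F)) (w : ℕ) : ℕ :=
  Set.ncard {c : Fin n → F | c ∈ C ∧ hammingNorm c = w}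

/-- The subfield `GF(p)(α^u)` has degree `ℓ_u`, the size of the cyclotomic coset of `u`. -/
theorem finrank_adjoin_pow (p m u : ℕ) [Fact p.Prime] {K : Type*} [Field K]
    [Algebra (ZMod p) K] (hK : Nat.card K = p ^ m) (hm : 0 < m) (α : Kˣ)
    (hα : ∀ x : Kˣ, x ∈ Subgroup.zpowers α) :
    Module.finrank (ZMod p) (ZMod p)⟮(α : K) ^ u⟯ = (cyclotomicCoset p (p ^ m - 1) u).ncard := by
  classical
  have hp : p.Prime := Fact.out
  have hn : 0 < p ^ m - 1 := Nat.sub_pos_of_lt (Nat.one_lt_pow hm.ne' hp.one_lt)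
  have : NeZero (p ^ m - 1) := ⟨hn.ne'⟩
  have : Finite K := Nat.finite_of_card_ne_zero (by rw [hK]; exact (pow_pos hp.pos m).ne')
  have : Fintype K := Fintype.ofFinite K
  have : Module.Finite (ZMod p) K := Module.Finite.of_finite
  have hord : orderOf α = p ^ m - 1 := by
    rw [orderOf_eq_card_of_forall_mem_zpowers hα, Nat.card_units, hK]
  have hpow : ∀ a b : ℕ, (α : K) ^ a = (α : K) ^ b ↔
      ((a : ZMod (p ^ m - 1)) = (b : ZMod (p ^ m - 1))) := by
    intro a b
    rw [ZMod.natCast_eq_natCast_iff, ← hord, ← pow_eq_pow_iff_modEq, Units.ext_iff]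
    simp
  set β : K := (α : K) ^ u with hβ
  have hint : IsIntegral (ZMod p) β := Algebra.IsIntegral.isIntegral β
  have hinj : Function.Injective (fun x : ZMod (p ^ m - 1) => (α : K) ^ x.val) := by
    intro x y hxy
    simpa using (hpow _ _).1 hxy
  have himg : (fun x : ZMod (p ^ m - 1) => (α : K) ^ x.val) '' cyclotomicCoset p (p ^ m - 1) u
      = (minpoly (ZMod p) β).rootSet K := by
    have key : ∀ j : ℕ, (α : K) ^ ((u : ZMod (p ^ m - 1)) * (p : ZMod (p ^ m - 1)) ^ j).val
        = β ^ p ^ j := by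
      intro j
      rw [hβ, ← pow_mul, hpow]
      simp
    have frob : ∀ j : ℕ, (FiniteField.frobeniusAlgEquivOfAlgebraic (ZMod p) K ^ j) β
        = β ^ p ^ j := by
      intro j
      rw [AlgEquiv.coe_pow, FiniteField.coe_frobeniusAlgEquivOfAlgebraic_iterate, ZMod.card]
    ext y
    rw [← isConjRoot_iff_mem_minpoly_rootSet hint,
      (⟨IsConjRoot.symm, IsConjRoot.symm⟩ : IsConjRoot (ZMod p) β y ↔ IsConjRoot (ZMod p) y β),
      isConjRoot_iff_exists_algEquiv]
    constructor
    · rintro ⟨x, ⟨j, rfl⟩, rfl⟩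
      exact ⟨FiniteField.frobeniusAlgEquivOfAlgebraic (ZMod p) K ^ j, by rw [frob, ← key]⟩
    · rintro ⟨σ, rfl⟩
      obtain ⟨j, rfl⟩ := (FiniteField.bijective_frobeniusAlgEquivOfAlgebraic_pow (ZMod p) K).2 σ
      exact ⟨_, ⟨j, rfl⟩, by simp only [frob, key]⟩
  rw [IntermediateField.adjoin.finrank hint,
    ← Polynomial.card_rootSet_eq_natDegree (K := K) (Algebra.IsSeparable.isSeparable (ZMod p) β)
      (Normal.splits inferInstance β),
    ← Set.ncard_image_of_injective _ hinj, himg, ← Nat.card_coe_set_eq, Nat.card_eq_fintype_card]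

/-! In all three cases `v` is odd and `v (3 ^ h + 1) ≡ 2` modulo `q - 1` for some `h` prime to `m`;
nothing else about `v` is needed. Since `v` is odd, `Tr (a x + b x ^ v)` takes the values 1 and 2
equally often, say `N` times each. The word of `(a, b)` thus has weight `2 N`, and its character sum
is the integer `T = q - 3 N`.

The map `x ↦ x ^ v` is a bijection whose inverse sends `z²` to `z ^ (3 ^ h + 1)`. As `-1` is a
nonsquare, `z²` and `-z²` together cover the field twice, so `2 T = S + conj S`, where `S` is the
character sum of the quadratic form `Tr (a z ^ (3 ^ h + 1) + b z²)`. Its radical has dimension `d ≤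
2` when `(a, b) ≠ 0`, and `|S|² = 3 ^ (m + d)`.

Writing `S` in terms of cube roots of unity gives `4 T² + 3 δ² = 4 · 3 ^ (m + d)` with `δ` an
integer. Descent at 3 forces `T = 0` for `m + d` odd and `T² = 3 ^ (m + d)` for `m + d` even. With
`m` odd, only `d = 1` gives a nonzero value, so `T` is `0` or `± 3 ^ ((m + 1) / 2)`. The first two
moments of `T` over all `(a, b)` then determine the three frequencies. -/

/-! ### Descent for a norm equation -/

/-- The integral solutions of `t² + 3 d² = 3 ^ k`. -/
theorem sq_add_three_mul_sq_eq_three_pow (k : ℕ) : ∀ t d : ℤ, t ^ 2 + 3 * d ^ 2 = 3 ^ k →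
    (Odd k → t = 0) ∧ (Even k → t ^ 2 = 3 ^ k) := by
  induction k using Nat.strong_induction_on with
  | _ k ih =>
    intro t d h
    match k, ih, h with
    | 0, _, h =>
      refine ⟨fun h => absurd h (by decide), fun _ => ?_⟩
      have hd : d = 0 := by
        by_contra hd
        have := sq_nonneg t
        have : 0 < d ^ 2 := by positivity
        simp at h
        omega
      simpa [hd] using h
    | 1, _, h =>
      have h3 : (3 : ℤ) ∣ t := Int.prime_three.dvd_of_dvd_pow (n := 2) ⟨1 - d ^ 2, by linarith⟩
      obtain ⟨s, rfl⟩ := h3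
      refine ⟨fun _ => ?_, fun h => absurd h (by decide)⟩
      by_contra hs
      have hs : s ≠ 0 := by rintro rfl; simp at hs
      have := sq_nonneg d
      have : 0 < s ^ 2 := by positivity
      nlinarith
    | k + 2, ih, h =>
      -- Descent: 3 divides `t`, hence also `d`; dividing both by 3 lowers the exponent by 2 and
      -- keeps its parity.
      have p2 : (3 : ℤ) ^ (k + 2) = 9 * 3 ^ k := by ring
      rw [p2] at h
      have h3 : (3 : ℤ) ∣ t := Int.prime_three.dvd_of_dvd_pow (n := 2)
        ⟨3 * 3 ^ k - d ^ 2, by linarith⟩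
      obtain ⟨s, rfl⟩ := h3
      have h3 : (3 : ℤ) ∣ d := Int.prime_three.dvd_of_dvd_pow (n := 2)
        ⟨3 ^ k - s ^ 2, by linarith⟩
      obtain ⟨e, rfl⟩ := h3
      obtain ⟨h1, h2⟩ := ih k (by omega) s e (by linarith)
      refine ⟨fun hk => ?_, fun hk => ?_⟩
      · rw [h1 (by simpa [Nat.odd_add] using hk)]; rfl
      · rw [mul_pow, h2 (by simpa [Nat.even_add] using hk)]; ring

/-- The integral solutions of `4 t² + 3 d² = 4 · 3 ^ k`. -/
theorem four_mul_sq_add_three_mul_sq_eq (k : ℕ) (t d : ℤ) (h : 4 * t ^ 2 + 3 * d ^ 2 = 4 * 3 ^ k) :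
    (Odd k → t = 0) ∧ (Even k → t ^ 2 = 3 ^ k) := by
  obtain ⟨e, rfl⟩ : Even d := by
    rw [← Int.even_pow' two_ne_zero (m := d)]
    exact (even_iff_two_dvd.2 (by omega))
  exact sq_add_three_mul_sq_eq_three_pow k t e (by linarith)

/-! ### Arithmetic of the exponent `v` -/

theorem three_pow_sub_one_half_odd {m : ℕ} (hodd : Odd m) : Odd ((3 ^ m - 1) / 2) := by
  obtain ⟨t, rfl⟩ := hodd
  have h : 3 ^ (2 * t + 1) % 4 = 3 := by
    rw [pow_succ, pow_mul, Nat.mul_mod, Nat.pow_mod]; norm_num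
  generalize 3 ^ (2 * t + 1) = x at *
  rw [Nat.odd_iff]; omega

theorem exponent_properties {m h : ℕ} (hm : 3 ≤ m) (hodd : Odd m)
    (hdvd : h ∣ m + 1) (heven : Even ((m + 1) / h)) {v : ℕ}
    (hv : v = (3 ^ (m + 1) - 1) / (3 ^ h + 1) + (3 ^ m - 1) / 2) :
    Odd v ∧ h < m ∧ Nat.Coprime h m ∧ v * (3 ^ h + 1) ≡ 2 [MOD 3 ^ m - 1] := by
  obtain ⟨c, hc⟩ := heven
  have hmc : m + 1 = 2 * h * c := by
    have := Nat.div_mul_cancel hdvd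
    rw [hc] at this; linarith
  have hc0 : c ≠ 0 := by rintro rfl; simp at hmc
  have hcop : Nat.Coprime h m := by
    have h1 : Nat.gcd h m ∣ 1 := by
      rw [Nat.dvd_add_iff_right (Nat.gcd_dvd_right h m)]
      exact (Nat.gcd_dvd_left h m).trans hdvd
    exact Nat.dvd_one.1 h1
  have hlt : h < m := by
    have : h * 1 ≤ h * c := Nat.mul_le_mul_left h (by omega)
    nlinarith
  obtain ⟨t, ht⟩ : 3 ^ (2 * h) - 1 ∣ 3 ^ (m + 1) - 1 := by
    rw [hmc, pow_mul 3 (2 * h)]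
    simpa only [one_pow] using Nat.sub_dvd_pow_sub_pow (3 ^ (2 * h)) 1 c
  have hfac : 3 ^ (2 * h) - 1 = (3 ^ h + 1) * (3 ^ h - 1) := by
    rw [mul_comm 2 h, pow_mul, ← Nat.sq_sub_sq, one_pow]
  have hs : (3 ^ (m + 1) - 1) / (3 ^ h + 1) = (3 ^ h - 1) * t := by
    rw [ht, hfac, mul_assoc, Nat.mul_div_cancel_left _ (by positivity)]
  have hsmul : (3 ^ h - 1) * t * (3 ^ h + 1) = 3 ^ (m + 1) - 1 := by rw [ht, hfac]; ring
  have h3h : Odd (3 ^ h) := Odd.pow (by decide)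
  have hseven : Even ((3 ^ h - 1) * t) := (Nat.Odd.sub_odd h3h odd_one).mul_right t
  rw [hs] at hv
  refine ⟨?_, hlt, hcop, ?_⟩
  · rw [hv]; exact hseven.add_odd (three_pow_sub_one_half_odd hodd)
  · obtain ⟨j, hj⟩ := h3h
    have h3m : Odd (3 ^ m) := Odd.pow (by decide)
    obtain ⟨i, hi⟩ := h3m
    -- The 3 comes from `3 ^ (m + 1) - 1 = 3 (3 ^ m - 1) + 2`, and `j + 1` is `(3 ^ h + 1) / 2`,
    -- from the summand `(3 ^ m - 1) / 2`.
    have e : v * (3 ^ h + 1) = 2 + (3 ^ m - 1) * (3 + (j + 1)) := by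
      rw [hv, add_mul, hsmul, hj, pow_succ, hi]
      have : (2 * i + 1 - 1) / 2 = i := by omega
      rw [this]
      have : (2 * i + 1) * 3 - 1 = 6 * i + 2 := by omega
      rw [this, Nat.add_sub_cancel]; ring
    rw [e]
    simp [Nat.ModEq]

/-- Repeated difference of squares shows that the second and third families are the first one with
`h = (m + 1) / 8` and `h = (m + 1) / 4`. -/
theorem exists_exponent {m : ℕ} (hm : 3 ≤ m) (hodd : Odd m) {v : ℕ}
    (hv : (∃ h : ℕ, 0 < h ∧ h ∣ m + 1 ∧ Even ((m + 1) / h) ∧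
            v = (3 ^ (m + 1) - 1) / (3 ^ h + 1) + (3 ^ m - 1) / 2) ∨
          (m % 8 = 7 ∧
            v = (3 ^ ((m + 1) / 8) - 1) * (3 ^ ((m + 1) / 4) + 1) * (3 ^ ((m + 1) / 2) + 1)
                  + (3 ^ m - 1) / 2) ∨
          (m % 4 = 3 ∧
            v = (3 ^ ((m + 1) / 4) - 1) * (3 ^ ((m + 1) / 2) + 1) + (3 ^ m - 1) / 2)) :
    Odd v ∧ ∃ h, 0 < h ∧ h < m ∧ Nat.Coprime h m ∧ v * (3 ^ h + 1) ≡ 2 [MOD 3 ^ m - 1] := by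
  have key : ∃ h : ℕ, 0 < h ∧ h ∣ m + 1 ∧ Even ((m + 1) / h) ∧
      v = (3 ^ (m + 1) - 1) / (3 ^ h + 1) + (3 ^ m - 1) / 2 := by
    have hsq : ∀ k : ℕ, 3 ^ (2 * k) - 1 = (3 ^ k - 1) * (3 ^ k + 1) := fun k => by
      rw [mul_comm 2 k, pow_mul, mul_comm, ← Nat.sq_sub_sq, one_pow]
    rcases hv with h | ⟨h8, h⟩ | ⟨h4, h⟩
    · exact h
    · obtain ⟨k, hk⟩ : 8 ∣ m + 1 := by omega
      refine ⟨k, by omega, ⟨8, by omega⟩, ?_, ?_⟩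
      · rw [hk, Nat.mul_div_cancel _ (by omega : 0 < k)]; decide
      · have e8 : (m + 1) / 8 = k := by omega
        have e4 : (m + 1) / 4 = 2 * k := by omega
        have e2 : (m + 1) / 2 = 2 * (2 * k) := by omega
        rw [h, e8, e4, e2]
        congr 1
        refine (Nat.div_eq_of_eq_mul_left (by positivity) ?_).symm
        rw [show m + 1 = 2 * (2 * (2 * k)) by omega, hsq, hsq, hsq]; ring
    · obtain ⟨k, hk⟩ : 4 ∣ m + 1 := by omega
      refine ⟨k, by omega, ⟨4, by omega⟩, ?_, ?_⟩
      · rw [hk, Nat.mul_div_cancel _ (by omega : 0 < k)]; decide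
      · have e4 : (m + 1) / 4 = k := by omega
        have e2 : (m + 1) / 2 = 2 * k := by omega
        rw [h, e4, e2]
        congr 1
        refine (Nat.div_eq_of_eq_mul_left (by positivity) ?_).symm
        rw [show m + 1 = 2 * (2 * k) by omega, hsq, hsq]; ring
  obtain ⟨h, h0, hd, he, hv⟩ := key
  obtain ⟨h1, h2, h3, h4⟩ := exponent_properties hm hodd hd he hv
  exact ⟨h1, h, h0, h2, h3, h4⟩

/-! ### Cyclotomic cosets -/

theorem three_pow_period {m : ℕ} (hm : 0 < m) :
    (3 : ZMod (3 ^ m - 1)) ^ m = 1 := by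
  have h : ((3 ^ m - 1 : ℕ) : ZMod (3 ^ m - 1)) = 0 := ZMod.natCast_self _
  rw [Nat.cast_sub (Nat.one_le_pow _ _ (by norm_num))] at h
  push_cast at h
  exact sub_eq_zero.1 h

theorem two_mul_three_pow_lt {m i : ℕ} (hm : 2 ≤ m) (hi : i < m) : 2 * 3 ^ i < 3 ^ m - 1 := by
  obtain ⟨k, rfl⟩ : ∃ k, m = k + 1 := ⟨m - 1, by omega⟩
  have h1 : 3 ^ i ≤ 3 ^ k := Nat.pow_le_pow_right (by norm_num) (by omega)
  have h2 : 3 ^ 1 ≤ 3 ^ k := Nat.pow_le_pow_right (by norm_num) (by omega)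
  rw [pow_succ]; omega

theorem natCast_zmod_inj {n a b : ℕ} (ha : a < n) (hb : b < n) (h : (a : ZMod n) = b) : a = b := by
  rw [ZMod.natCast_eq_natCast_iff] at h
  exact Nat.ModEq.eq_of_lt_of_lt h ha hb

theorem two_mul_three_pow_injOn {m i j : ℕ} (hm : 2 ≤ m) (hi : i < m) (hj : j < m)
    (h : (2 : ZMod (3 ^ m - 1)) * 3 ^ i = 2 * 3 ^ j) : i = j := by
  have := natCast_zmod_inj (two_mul_three_pow_lt hm hi) (two_mul_three_pow_lt hm hj)
    (by exact_mod_cast h)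
  simpa using this

/-- Multiplication by `c` carries `u 3 ^ j` to `2 · 3 ^ j`, and these are distinct for `j < m`
because they stay below the modulus. -/
theorem ncard_cyclotomicCoset_of_mul_eq_two {m u c : ℕ} (hm : 2 ≤ m)
    (h : (u : ZMod (3 ^ m - 1)) * c = 2) : (cyclotomicCoset 3 (3 ^ m - 1) u).ncard = m := by
  have himg : cyclotomicCoset 3 (3 ^ m - 1) u
      = (fun j : ℕ => (u : ZMod (3 ^ m - 1)) * 3 ^ j) '' (Finset.range m : Set ℕ) := by
    ext x
    constructor
    · rintro ⟨j, rfl⟩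
      refine ⟨j % m, by simpa using Nat.mod_lt _ (by omega), ?_⟩
      conv_rhs => rw [← Nat.div_add_mod j m, pow_add, pow_mul]
      simp [three_pow_period (show 0 < m by omega)]
    · rintro ⟨j, -, rfl⟩
      exact ⟨j, by simp⟩
  rw [himg, Set.InjOn.ncard_image, Set.ncard_coe_finset, Finset.card_range]
  intro i hi j hj hij
  simp only [Finset.coe_range, Set.mem_Iio] at hi hj
  refine two_mul_three_pow_injOn hm hi hj ?_
  have := congrArg (· * (c : ZMod (3 ^ m - 1))) hij
  simpa [mul_right_comm, h] using this

/-- A common element would make `v` inverse to a power `3 ^ k`, so `3 ^ h + 1 ≡ 2 · 3 ^ k`. Both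
sides are below the modulus, hence equal, which is impossible for `h > 0`. -/
theorem disjoint_cyclotomicCoset {m h v : ℕ} (hm : 2 ≤ m) (h0 : 0 < h) (hhm : h < m)
    (hv : (v : ZMod (3 ^ m - 1)) * (3 ^ h + 1 : ℕ) = 2) :
    Disjoint (cyclotomicCoset 3 (3 ^ m - 1) 1) (cyclotomicCoset 3 (3 ^ m - 1) v) := by
  rw [Set.disjoint_left]
  rintro x ⟨i, hi⟩ ⟨j, hj⟩
  have hper := three_pow_period (show 0 < m by omega)
  rw [hi] at hj
  simp only [Nat.cast_one, one_mul, Nat.cast_ofNat] at hj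
  -- Since `3 ^ m = 1`, the factor `3 ^ ((m - 1) i)` is the inverse of `3 ^ i`.
  obtain ⟨k, hk, hpow⟩ : ∃ k < m, (3 : ZMod (3 ^ m - 1)) ^ (j + (m - 1) * i) = 3 ^ k := by
    refine ⟨(j + (m - 1) * i) % m, Nat.mod_lt _ (by omega), ?_⟩
    conv_lhs => rw [← Nat.div_add_mod (j + (m - 1) * i) m, pow_add, pow_mul, hper, one_pow, one_mul]
  have e : ((3 ^ h + 1 : ℕ) : ZMod (3 ^ m - 1)) = (2 * 3 ^ k : ℕ) := by
    push_cast
    rw [← hpow, ← hv, pow_add]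
    have h1 : (3 : ZMod (3 ^ m - 1)) ^ i * 3 ^ ((m - 1) * i) = 1 := by
      rw [← pow_add, show i + (m - 1) * i = m * i by
        obtain ⟨c, rfl⟩ : ∃ c, m = c + 1 := ⟨m - 1, by omega⟩
        simp; ring, pow_mul, hper, one_pow]
    have h2 : (v : ZMod (3 ^ m - 1)) * 3 ^ j * 3 ^ ((m - 1) * i) = 1 := by rw [← hj, h1]
    push_cast
    linear_combination (-(3 : ZMod (3 ^ m - 1)) ^ h - 1) * h2
  have hb := two_mul_three_pow_lt hm hhm
  have hpos : 0 < 3 ^ h := by positivity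
  have heq := natCast_zmod_inj (by omega) (two_mul_three_pow_lt hm hk) e
  obtain ⟨a, rfl⟩ : ∃ a, h = a + 1 := ⟨h - 1, by omega⟩
  rcases k with - | k
  · have : 0 < 3 ^ a := by positivity
    rw [pow_succ] at heq; omega
  · rw [pow_succ, pow_succ] at heq; omega

/-! ### Sums of cube roots of unity -/

open scoped ComplexConjugate

/-- The number of times a `ZMod 3`-valued function takes the value `t`. -/
noncomputable def valueCount {X : Type*} [Fintype X] (f : X → ZMod 3) (t : ZMod 3) : ℕ :=
  (Finset.univ.filter fun x => f x = t).card

theorem sum_zmod_three {M : Type*} [AddCommMonoid M] (g : ZMod 3 → M) :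
    ∑ t, g t = g 0 + g 1 + g 2 :=
  Fin.sum_univ_three g

theorem stdAddChar_three_sum :
    1 + ZMod.stdAddChar (1 : ZMod 3) + ZMod.stdAddChar (2 : ZMod 3) = 0 := by
  have h := AddChar.sum_eq_zero_of_ne_one (ψ := (ZMod.stdAddChar : AddChar (ZMod 3) ℂ))
    (by
      have := ZMod.isPrimitive_stdAddChar 3 (a := 1) one_ne_zero
      simpa [AddChar.mulShift_one] using this)
  rwa [sum_zmod_three, AddChar.map_zero_eq_one] at h

theorem stdAddChar_three_two : ZMod.stdAddChar (2 : ZMod 3) = ZMod.stdAddChar (1 : ZMod 3) ^ 2 := by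
  rw [← AddChar.map_nsmul_eq_pow]; rfl

theorem conj_stdAddChar_three_one :
    conj (ZMod.stdAddChar (1 : ZMod 3)) = ZMod.stdAddChar (2 : ZMod 3) := by
  rw [← AddChar.map_neg_eq_conj]; rfl

theorem conj_stdAddChar_three_two :
    conj (ZMod.stdAddChar (2 : ZMod 3)) = ZMod.stdAddChar (1 : ZMod 3) := by
  rw [← AddChar.map_neg_eq_conj]; rfl

section counting
variable {X : Type*} [Fintype X] (f : X → ZMod 3)

theorem sum_stdAddChar_comp : ∑ x, ZMod.stdAddChar (f x) =
    (valueCount f 0 : ℂ) + valueCount f 1 * ZMod.stdAddChar (1 : ZMod 3)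
      + valueCount f 2 * ZMod.stdAddChar (2 : ZMod 3) := by
  rw [← Finset.sum_fiberwise Finset.univ f]
  have h : ∀ t : ZMod 3, ∑ x with f x = t, ZMod.stdAddChar (f x) =
      (valueCount f t : ℂ) * ZMod.stdAddChar t := by
    intro t
    rw [Finset.sum_congr rfl (g := fun _ => ZMod.stdAddChar t)
      (fun x hx => by rw [(Finset.mem_filter.1 hx).2]), Finset.sum_const, nsmul_eq_mul, valueCount]
  simp_rw [h]
  rw [sum_zmod_three, AddChar.map_zero_eq_one, mul_one]

theorem sum_valueCount : valueCount f 0 + valueCount f 1 + valueCount f 2 = Fintype.card X := by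
  have := Finset.card_eq_sum_card_fiberwise (f := f) (s := Finset.univ) (t := Finset.univ)
    (fun x _ => Finset.mem_coe.2 (Finset.mem_univ _))
  rw [← Finset.card_univ, this, sum_zmod_three]; rfl

/-- This is `4 |S|² = (S + conj S)² - (S - conj S)²`, where `S - conj S` is `± √-3` times the
difference of the counts of 1 and 2. -/
theorem four_mul_sum_mul_conj :
    4 * ((∑ x, ZMod.stdAddChar (f x)) * conj (∑ x, ZMod.stdAddChar (f x))) =
      ((∑ x, ZMod.stdAddChar (f x)) + conj (∑ x, ZMod.stdAddChar (f x))) ^ 2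
        + 3 * ((valueCount f 1 : ℂ) - valueCount f 2) ^ 2 := by
  rw [sum_stdAddChar_comp]
  simp only [map_add, map_mul, conj_stdAddChar_three_one, conj_stdAddChar_three_two,
    Complex.conj_natCast]
  have h1 := stdAddChar_three_sum
  have h2 := stdAddChar_three_two
  have h3 : ZMod.stdAddChar (2 : ZMod 3) = -1 - ZMod.stdAddChar (1 : ZMod 3) := by
    linear_combination h1
  have h4 : ZMod.stdAddChar (1 : ZMod 3) ^ 2 = -1 - ZMod.stdAddChar (1 : ZMod 3) := h2 ▸ h3
  rw [h3]
  linear_combination (-4 * ((valueCount f 1 : ℂ) - valueCount f 2) ^ 2) * h4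

theorem sum_stdAddChar_of_odd [Neg X] (hneg : Function.Involutive (Neg.neg : X → X))
    (hf : ∀ x, f (-x) = - f x) :
    valueCount f 1 = valueCount f 2 ∧
    ∑ x, ZMod.stdAddChar (f x) = (Fintype.card X : ℂ) - 3 * valueCount f 1 := by
  have h12 : valueCount f 1 = valueCount f 2 := by
    refine Finset.card_bij' (fun x _ => -x) (fun x _ => -x) ?_ ?_ (fun x _ => hneg x)
      (fun x _ => hneg x)
    · intro x hx
      simp only [Finset.mem_filter, Finset.mem_univ, true_and] at hx ⊢
      rw [hf, hx]; rfl
    · intro x hx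
      simp only [Finset.mem_filter, Finset.mem_univ, true_and] at hx ⊢
      rw [hf, hx]; rfl
  refine ⟨h12, ?_⟩
  rw [sum_stdAddChar_comp, ← sum_valueCount f, ← h12]
  have h3 : ZMod.stdAddChar (2 : ZMod 3) = -1 - ZMod.stdAddChar (1 : ZMod 3) := by
    linear_combination stdAddChar_three_sum
  rw [h3]; push_cast; ring

end counting

/-! ### Quadratic forms and their radicals -/

section field
variable {K : Type*} [Field K] [Algebra (ZMod 3) K]

/-- The canonical additive character of a finite field of characteristic three. -/
noncomputable def traceChar (K : Type*) [Field K] [Algebra (ZMod 3) K] : AddChar K ℂ :=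
  (ZMod.stdAddChar : AddChar (ZMod 3) ℂ).compAddMonoidHom
    (Algebra.trace (ZMod 3) K).toAddMonoidHom

theorem traceChar_apply (x : K) :
    traceChar K x = ZMod.stdAddChar (Algebra.trace (ZMod 3) K x) := rfl

theorem eq_zero_or_one_or_neg_one_of_cube_eq {K : Type*} [Field K] {x : K} (hx : x ^ 3 = x) :
    x = 0 ∨ x = 1 ∨ x = -1 := by
  have : x * ((x - 1) * (x + 1)) = 0 := by linear_combination hx
  rcases mul_eq_zero.1 this with h | h
  · exact Or.inl h
  · rcases mul_eq_zero.1 h with h | h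
    · exact Or.inr (Or.inl (sub_eq_zero.1 h))
    · exact Or.inr (Or.inr (eq_neg_of_add_eq_zero_left h))

theorem two_ne_zero_of_three (K : Type*) [Field K] [Algebra (ZMod 3) K] : (2 : K) ≠ 0 := by
  have h : (algebraMap (ZMod 3) K) 2 = 2 := map_ofNat _ 2
  rw [← h]
  exact (map_ne_zero _).2 (by decide)

/-- The linear operator whose kernel is the radical of the quadratic form
`z ↦ Tr (a z σ(z) + b z²)`. -/
noncomputable def radicalMap (σ : K ≃ₐ[ZMod 3] K) (a b : K) : K →ₗ[ZMod 3] K :=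
  LinearMap.mulLeft (ZMod 3) (σ a) ∘ₗ (σ.toLinearMap ∘ₗ σ.toLinearMap)
    + LinearMap.mulLeft (ZMod 3) (2 * σ b) ∘ₗ σ.toLinearMap
    + LinearMap.mulLeft (ZMod 3) a

theorem radicalMap_apply (σ : K ≃ₐ[ZMod 3] K) (a b z : K) :
    radicalMap σ a b z = σ a * σ (σ z) + 2 * σ b * σ z + a * z := rfl

/-- The trace is `σ`-invariant, so applying `σ` to the terms that contain `w` itself makes `σ w` a
common factor of the polar form. -/
theorem trace_polar (σ : K ≃ₐ[ZMod 3] K) (a b z w : K) :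
    Algebra.trace (ZMod 3) K (a * (z * σ w + w * σ z) + 2 * b * z * w) =
      Algebra.trace (ZMod 3) K (radicalMap σ a b z * σ w) := by
  have h : ∀ x, Algebra.trace (ZMod 3) K (σ x) = Algebra.trace (ZMod 3) K x :=
    Algebra.trace_eq_of_algEquiv σ
  have e1 : a * (z * σ w + w * σ z) + 2 * b * z * w
      = a * z * σ w + (a * w * σ z + 2 * b * z * w) := by ring
  have e2 : radicalMap σ a b z * σ w = a * z * σ w + σ (a * w * σ z + 2 * b * z * w) := by
    rw [radicalMap_apply]; simp only [map_add, map_mul, map_ofNat]; ring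
  rw [e1, e2, map_add, map_add _ (a * z * σ w), h]

-- The ratios lie in the fixed field of `σ`, which is contained in `{0, 1, -1}`.
open Classical in
theorem card_le_three_of_ratio_fixed (σ : K ≃ₐ[ZMod 3] K) (hσ : ∀ x, σ x = x → x ^ 3 = x)
    (s : Finset K) (c w₀ : K) (hw₀ : w₀ ≠ 0)
    (h : ∀ w ∈ s, σ ((w - c) / w₀) = (w - c) / w₀) : s.card ≤ 3 := by
  have hs : s ⊆ {c, c + w₀, c - w₀} := by
    intro w hw
    simp only [Finset.mem_insert, Finset.mem_singleton]
    have e : w = c + (w - c) / w₀ * w₀ := by field_simp; ring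
    rcases eq_zero_or_one_or_neg_one_of_cube_eq (hσ _ (h w hw)) with h | h | h <;> rw [h] at e
    · left; rw [e]; ring
    · right; left; rw [e]; ring
    · right; right; rw [e]; ring
  exact (Finset.card_le_card hs).trans Finset.card_le_three

variable [Fintype K]

theorem traceChar_isPrimitive : (traceChar K).IsPrimitive := by
  have : Module.Finite (ZMod 3) K := Module.Finite.of_finite
  refine AddChar.IsPrimitive.of_ne_one fun h => ?_
  obtain ⟨x, hx⟩ := Algebra.trace_surjective (ZMod 3) K 1
  have h1 : traceChar K x = 1 := by rw [h]; rfl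
  rw [traceChar_apply, hx] at h1
  have := (ZMod.injective_stdAddChar (N := 3)) (h1.trans (AddChar.map_zero_eq_one _).symm)
  exact one_ne_zero this

open Classical in
theorem sum_traceChar_mul (a : K) :
    ∑ x, traceChar K (x * a) = if a = 0 then (Fintype.card K : ℂ) else 0 := by
  rw [AddChar.sum_mulShift a traceChar_isPrimitive]; split_ifs <;> simp

open Classical in
theorem sum_traceChar_mul' (a : K) :
    ∑ x, traceChar K (a * x) = if a = 0 then (Fintype.card K : ℂ) else 0 := by
  simp_rw [mul_comm a, sum_traceChar_mul]

/-- Substituting `z + w` for `z` in `S · conj S` makes the phase additive in `w`; by orthogonality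
only `z` in the radical survive, each contributing `q`. -/
theorem quadratic_sum_mul_conj (σ : K ≃ₐ[ZMod 3] K) (a b : K) :
    (∑ z, traceChar K (a * (z * σ z) + b * z ^ 2)) *
        conj (∑ z, traceChar K (a * (z * σ z) + b * z ^ 2)) =
      (Fintype.card K : ℂ) * 3 ^ Module.finrank (ZMod 3) (LinearMap.ker (radicalMap σ a b)) := by
  classical
  have step : ∀ z, ∑ w, traceChar K (a * ((z + w) * σ (z + w)) + b * (z + w) ^ 2)
        * conj (traceChar K (a * (w * σ w) + b * w ^ 2)) =
      if z ∈ LinearMap.ker (radicalMap σ a b) then (Fintype.card K : ℂ) else 0 := by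
    intro z
    have e : ∀ w, traceChar K (a * ((z + w) * σ (z + w)) + b * (z + w) ^ 2)
        * conj (traceChar K (a * (w * σ w) + b * w ^ 2)) =
        traceChar K (a * (z * σ z) + b * z ^ 2) * traceChar K (radicalMap σ a b z * σ w) := by
      intro w
      rw [← AddChar.map_neg_eq_conj, traceChar_apply (radicalMap σ a b z * σ w), ← trace_polar,
        ← traceChar_apply, ← AddChar.map_add_eq_mul, ← AddChar.map_add_eq_mul, map_add σ]
      congr 1; ring
    simp_rw [e]
    have hσ : ∑ w, traceChar K (radicalMap σ a b z * σ w)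
        = ∑ w, traceChar K (radicalMap σ a b z * w) :=
      Equiv.sum_comp σ.toEquiv (fun w => traceChar K (radicalMap σ a b z * w))
    rw [← Finset.mul_sum, hσ, sum_traceChar_mul', LinearMap.mem_ker]
    split_ifs with h
    -- The polar form at `(z, z)` is twice the quadratic form, so the form vanishes on the radical.
    · have h2 := trace_polar σ a b z z
      rw [h, zero_mul, map_zero] at h2
      have h3 : Algebra.trace (ZMod 3) K (a * (z * σ z) + b * z ^ 2) = 0 := by
        have : a * (z * σ z + z * σ z) + 2 * b * z * z =
          (2 : ZMod 3) • (a * (z * σ z) + b * z ^ 2) := by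
          rw [Algebra.smul_def, map_ofNat]; ring
        rw [this, map_smul, smul_eq_mul] at h2
        exact (mul_eq_zero.1 h2).resolve_left (by decide)
      rw [traceChar_apply, h3, AddChar.map_zero_eq_one, one_mul]
    · rw [mul_zero]
  rw [map_sum, Finset.sum_mul_sum, Finset.sum_comm]
  have shift : ∀ w, ∑ z, traceChar K (a * (z * σ z) + b * z ^ 2)
        * conj (traceChar K (a * (w * σ w) + b * w ^ 2)) =
      ∑ z, traceChar K (a * ((z + w) * σ (z + w)) + b * (z + w) ^ 2)
        * conj (traceChar K (a * (w * σ w) + b * w ^ 2)) := fun w =>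
    (Equiv.sum_comp (Equiv.addRight w) (fun z => traceChar K (a * (z * σ z) + b * z ^ 2)
        * conj (traceChar K (a * (w * σ w) + b * w ^ 2)))).symm
  simp_rw [shift]
  rw [Finset.sum_comm]
  simp_rw [step]
  rw [← Finset.sum_filter, Finset.sum_const, nsmul_eq_mul, mul_comm]
  congr 1
  have hc := Module.card_eq_pow_finrank (K := ZMod 3) (V := LinearMap.ker (radicalMap σ a b))
  rw [ZMod.card] at hc
  have hc' := congrArg (fun n : ℕ => (n : ℂ)) hc
  push_cast at hc'
  rw [← hc']
  congr 1
  exact (Fintype.card_subtype _).symm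

/-- The radical is the solution space of a second-order `σ`-difference equation. Reduction of order
by a nonzero solution `z₁` leaves at most 3 values of `D`, with at most 3 solutions over each, so at
most 9 in all. -/
theorem finrank_radical_le_two (σ : K ≃ₐ[ZMod 3] K) (hσ : ∀ x, σ x = x → x ^ 3 = x) {a b : K}
    (hab : (a, b) ≠ 0) :
    Module.finrank (ZMod 3) (LinearMap.ker (radicalMap σ a b)) ≤ 2 := by
  classical
  by_contra! hlt
  have hpow : 3 ^ 3 ≤ Fintype.card (LinearMap.ker (radicalMap σ a b)) := by
    rw [Module.card_eq_pow_finrank (K := ZMod 3), ZMod.card]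
    exact Nat.pow_le_pow_right (by norm_num) hlt
  obtain ⟨⟨z₁, hz₁⟩, hne⟩ : ∃ z : LinearMap.ker (radicalMap σ a b), z ≠ 0 := by
    have : 1 < Fintype.card (LinearMap.ker (radicalMap σ a b)) := by omega
    have := Fintype.one_lt_card_iff_nontrivial.1 this
    exact exists_ne 0
  have hz0 : z₁ ≠ 0 := fun h => hne (Subtype.ext h)
  rw [LinearMap.mem_ker, radicalMap_apply] at hz₁
  have hσz : ∀ {x : K}, x ≠ 0 → σ x ≠ 0 := fun h => (map_ne_zero σ).2 h
  by_cases ha : a = 0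
  · subst ha
    have hb : b ≠ 0 := fun h => hab (by rw [h]; rfl)
    simp only [map_zero, zero_mul, zero_add, add_zero] at hz₁
    exact mul_ne_zero (mul_ne_zero (two_ne_zero_of_three K) (hσz hb)) (hσz hz0) hz₁
  set s : Finset K := Finset.univ.filter fun z => radicalMap σ a b z = 0 with hs
  have hcard : s.card = Fintype.card (LinearMap.ker (radicalMap σ a b)) := by
    rw [hs, Fintype.card_subtype]; rfl
  set D : K → K := fun z => σ (z / z₁) - z / z₁ with hD
  -- Eliminating the middle coefficient between the equations for `z` and `z₁` gives a first-order
  -- equation for `D z`, so ratios of its solutions are `σ`-fixed.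
  have hfirst : ∀ z ∈ s, σ a * σ (σ z₁) * σ (D z) = a * z₁ * D z := by
    intro z hz
    have hz := (Finset.mem_filter.1 hz).2
    rw [radicalMap_apply] at hz
    have h1 := hσz hz0
    have h2 := hσz h1
    simp only [hD, map_sub, map_div₀]
    field_simp
    linear_combination (σ z₁) * hz - (σ z) * hz₁
  have himg : (s.image D).card ≤ 3 := by
    by_cases hz : ∃ w ∈ s.image D, w ≠ 0
    · obtain ⟨w₀, hw₀, hw0⟩ := hz
      refine card_le_three_of_ratio_fixed σ hσ _ 0 w₀ hw0 fun w hw => ?_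
      obtain ⟨z, hz, rfl⟩ := Finset.mem_image.1 hw
      obtain ⟨y, hy, rfl⟩ := Finset.mem_image.1 hw₀
      have e1 := hfirst z hz
      have e2 := hfirst y hy
      have hy' := hσz hw0
      have hne : σ a * σ (σ z₁) ≠ 0 := mul_ne_zero (hσz ha) (hσz (hσz hz0))
      rw [sub_zero, map_div₀, div_eq_div_iff hy' hw0]
      refine mul_left_cancel₀ hne ?_
      linear_combination D y * e1 - D z * e2
    · push Not at hz
      have : s.image D ⊆ {0} := fun w hw => Finset.mem_singleton.2 (hz w hw)
      exact (Finset.card_le_card this).trans (by simp)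
  have hfib : s.card ≤ 3 * (s.image D).card := by
    refine Finset.card_le_mul_card_image s 3 fun w hw => ?_
    obtain ⟨y, hy, rfl⟩ := Finset.mem_image.1 hw
    refine card_le_three_of_ratio_fixed σ hσ _ y z₁ hz0 fun z hz => ?_
    have e := (Finset.mem_filter.1 hz).2
    simp only [hD] at e
    rw [sub_div, map_sub]
    linear_combination e
  omega

theorem three_valued_of_quadratic {m : ℕ} (hodd : Odd m) (hK : Fintype.card K = 3 ^ m)
    (σ : K ≃ₐ[ZMod 3] K) (hσ : ∀ x, σ x = x → x ^ 3 = x) {a b : K} (hab : (a, b) ≠ 0) (T : ℤ)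
    (hT : (∑ z, traceChar K (a * (z * σ z) + b * z ^ 2)) +
        conj (∑ z, traceChar K (a * (z * σ z) + b * z ^ 2)) = 2 * T) :
    T = 0 ∨ T = 3 ^ ((m + 1) / 2) ∨ T = -3 ^ ((m + 1) / 2) := by
  have h4 := four_mul_sum_mul_conj (fun z => Algebra.trace (ZMod 3) K (a * (z * σ z) + b * z ^ 2))
  have hle := finrank_radical_le_two σ hσ hab
  have hS := quadratic_sum_mul_conj σ a b
  simp only [traceChar_apply] at hS hT
  rw [hT, hS, hK] at h4
  set d := Module.finrank (ZMod 3) (LinearMap.ker (radicalMap σ a b))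
  obtain ⟨h1, h2⟩ := four_mul_sq_add_three_mul_sq_eq (m + d) T
    (valueCount (fun z => Algebra.trace (ZMod 3) K (a * (z * σ z) + b * z ^ 2)) 1 -
      valueCount (fun z => Algebra.trace (ZMod 3) K (a * (z * σ z) + b * z ^ 2)) 2) (by
      have : (4 * T ^ 2 + 3 * ((valueCount
        (fun z => Algebra.trace (ZMod 3) K (a * (z * σ z) + b * z ^ 2)) 1 : ℂ) -
        valueCount (fun z => Algebra.trace (ZMod 3) K (a * (z * σ z) + b * z ^ 2)) 2) ^ 2 : ℂ)
          = 4 * 3 ^ (m + d) := by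
        rw [pow_add]; push_cast at h4; linear_combination -h4
      exact_mod_cast this)
  obtain ⟨t, rfl⟩ := hodd
  have hd : d = 1 ∨ Even d := by
    have : d ≤ 2 := hle
    interval_cases d <;> decide
  rcases hd with hd | hd
  · right
    have := h2 (by rw [hd]; exact ⟨t + 1, by ring⟩)
    rw [hd] at this
    have e : (2 * t + 1 + 1) / 2 = t + 1 := by omega
    rw [e]
    refine sq_eq_sq_iff_eq_or_eq_neg.1 ?_
    rw [this, ← pow_mul]; congr 1; ring
  · left
    exact h1 (Odd.add_even ⟨t, rfl⟩ hd)

/-- An element `y` has `1 + η(y)` square roots, `η` the quadratic character, and `η(-y) = -η(y)`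
because `q ≡ 3` modulo 4; the two counts add up to 2. -/
theorem sum_square_add_sum_neg_square {m : ℕ} (hodd : Odd m) (hK : Fintype.card K = 3 ^ m)
    (g : K → ℂ) : ∑ z, g (z ^ 2) + ∑ z, g (-z ^ 2) = 2 * ∑ y, g y := by
  classical
  have hchar : ringChar K ≠ 2 := by
    intro h
    have := ringChar.Nat.cast_ringChar (R := K)
    rw [h] at this
    exact two_ne_zero_of_three K this
  have hsq : ∀ g : K → ℂ, ∑ z, g (z ^ 2) = ∑ y, ((quadraticChar K y : ℤ) + 1 : ℂ) * g y := by
    intro g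
    rw [← Finset.sum_fiberwise Finset.univ (fun z : K => z ^ 2)]
    refine Finset.sum_congr rfl fun y _ => ?_
    rw [Finset.sum_congr rfl (g := fun _ => g y)
      (fun x hx => by rw [(Finset.mem_filter.1 hx).2]), Finset.sum_const, nsmul_eq_mul]
    have h := quadraticChar_card_sqrts hchar y
    rw [Set.toFinset_ofPred] at h
    have h' := congrArg (fun n : ℤ => (n : ℂ)) h
    push_cast at h'
    rw [h']
  have hneg : quadraticChar K (-1) = -1 := by
    rw [quadraticChar_neg_one_iff_not_isSquare, FiniteField.isSquare_neg_one_iff, not_not, hK]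
    obtain ⟨t, rfl⟩ := hodd
    rw [pow_succ, pow_mul, Nat.mul_mod, Nat.pow_mod]; norm_num
  have h2 := hsq (fun y => g (-y))
  rw [← Equiv.sum_comp (Equiv.neg K) (fun y => _ * g (-y))] at h2
  rw [hsq g, h2, ← Finset.sum_add_distrib, Finset.mul_sum]
  refine Finset.sum_congr rfl fun y _ => ?_
  have : quadraticChar K (-y) = - quadraticChar K y := by
    rw [← neg_one_mul, map_mul, hneg, neg_one_mul]
  simp only [Equiv.neg_apply, neg_neg, this]
  push_cast; ring

end field

/-! ### The sums of `Tr (a x + b x ^ v)` and their moments -/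

theorem pow_mul_eq_sq {K : Type*} [Field K] [Fintype K] {m v k : ℕ} (hK : Fintype.card K = 3 ^ m) (hv : v ≠ 0) (hk : k ≠ 0)
    (h : v * k ≡ 2 [MOD 3 ^ m - 1]) (x : K) : x ^ (v * k) = x ^ 2 := by
  by_cases hx : x = 0
  · rw [hx, zero_pow (mul_ne_zero hv hk), zero_pow two_ne_zero]
  · have hu : x ^ (3 ^ m - 1) = 1 := by rw [← hK]; exact FiniteField.pow_card_sub_one_eq_one x hx
    have hu' : (Units.mk0 x hx) ^ (3 ^ m - 1) = 1 := Units.ext (by simpa using hu)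
    have := pow_eq_pow_iff_modEq.2 (h.of_dvd (orderOf_dvd_of_pow_eq_one hu'))
    simpa using congrArg Units.val this

/-- For `x ≠ 0` the order divides `gcd (3 ^ h - 1, 3 ^ m - 1) = 3 ^ gcd (h, m) - 1 = 2`. -/
theorem pow_three_eq_self_of_frobenius_fixed {K : Type*} [Field K] [Fintype K] {m h : ℕ} (hK : Fintype.card K = 3 ^ m)
    (hcop : Nat.Coprime h m) {x : K} (hx : x ^ 3 ^ h = x) : x ^ 3 = x := by
  by_cases h0 : x = 0
  · simp [h0]
  have h1 : x ^ (3 ^ m - 1) = 1 := by rw [← hK]; exact FiniteField.pow_card_sub_one_eq_one x h0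
  have h2 : x ^ (3 ^ h - 1) = 1 := by
    refine mul_right_cancel₀ h0 ?_
    rw [← pow_succ, Nat.sub_add_cancel (Nat.one_le_pow _ _ (by norm_num)), hx, one_mul]
  have h3 := orderOf_dvd_iff_pow_eq_one.1
    (Nat.dvd_gcd (orderOf_dvd_of_pow_eq_one h2) (orderOf_dvd_of_pow_eq_one h1))
  rw [Nat.pow_sub_one_gcd_pow_sub_one, hcop.gcd_eq_one] at h3
  rw [pow_succ, show x ^ 2 = 1 from h3, one_mul]

section powerSum
variable {K : Type*} [Field K] [Algebra (ZMod 3) K]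

theorem trace_mul_add_pow_neg {v : ℕ} (hv : Odd v) (p : K × K) (x : K) :
    Algebra.trace (ZMod 3) K (p.1 * (-x) + p.2 * (-x) ^ v) =
      -Algebra.trace (ZMod 3) K (p.1 * x + p.2 * x ^ v) := by
  rw [hv.neg_pow, ← map_neg]; congr 1; ring

variable [Fintype K]

/-- The number of `x` with `Tr (a x + b x ^ v) = 1`. -/
noncomputable def traceOneCount (v : ℕ) (p : K × K) : ℕ :=
  valueCount (fun x : K => Algebra.trace (ZMod 3) K (p.1 * x + p.2 * x ^ v)) 1

theorem sum_traceChar_mul_add_pow {v : ℕ} (hv : Odd v) (p : K × K) :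
    ∑ x, traceChar K (p.1 * x + p.2 * x ^ v) = (Fintype.card K : ℂ) - 3 * traceOneCount v p :=
  (sum_stdAddChar_of_odd _ neg_involutive (trace_mul_add_pow_neg hv p)).2

theorem card_trace_ne_zero {v : ℕ} (hv : Odd v) (p : K × K) :
    (Finset.univ.filter fun x : K =>
      Algebra.trace (ZMod 3) K (p.1 * x + p.2 * x ^ v) ≠ 0).card = 2 * traceOneCount v p := by
  have h12 := (sum_stdAddChar_of_odd
    (fun x : K => Algebra.trace (ZMod 3) K (p.1 * x + p.2 * x ^ v)) neg_involutive (trace_mul_add_pow_neg hv p)).1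
  have hsum := sum_valueCount fun x : K => Algebra.trace (ZMod 3) K (p.1 * x + p.2 * x ^ v)
  have hc := Finset.card_filter_add_card_filter_not (s := (Finset.univ : Finset K))
    (fun x => Algebra.trace (ZMod 3) K (p.1 * x + p.2 * x ^ v) = 0)
  rw [Finset.card_univ, ← hsum, ← h12] at hc
  rw [traceOneCount]
  simp only [valueCount] at hc ⊢
  simp only [ne_eq]
  omega

theorem first_moment {v : ℕ} (hv : Odd v) :
    ∑ p : K × K, ((Fintype.card K : ℤ) - 3 * traceOneCount v p) = (Fintype.card K : ℤ) ^ 2 := by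
  classical
  have h : ∑ p : K × K, ((Fintype.card K : ℂ) - 3 * traceOneCount v p)
      = (Fintype.card K : ℂ) ^ 2 := by
    simp_rw [← sum_traceChar_mul_add_pow hv]
    rw [Finset.sum_comm]
    have e : ∀ x : K, ∑ p : K × K, traceChar K (p.1 * x + p.2 * x ^ v) =
        if x = 0 then (Fintype.card K : ℂ) ^ 2 else 0 := by
      intro x
      simp_rw [AddChar.map_add_eq_mul]
      rw [Fintype.sum_prod_type]
      simp_rw [← Finset.mul_sum]
      rw [← Finset.sum_mul, sum_traceChar_mul, sum_traceChar_mul]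
      simp only [pow_eq_zero_iff hv.pos.ne']
      split_ifs <;> ring
    simp_rw [e]
    simp
  exact_mod_cast h

/-- Orthogonality in both coordinates keeps the pairs with `x + y = 0` and `x ^ v + y ^ v = 0`. As
`v` is odd the first implies the second, leaving `q` pairs of weight `q²`. -/
theorem second_moment {v : ℕ} (hv : Odd v) :
    ∑ p : K × K, ((Fintype.card K : ℤ) - 3 * traceOneCount v p) ^ 2 = (Fintype.card K : ℤ) ^ 3 := by
  classical
  have h : ∑ p : K × K, ((Fintype.card K : ℂ) - 3 * traceOneCount v p) ^ 2
      = (Fintype.card K : ℂ) ^ 3 := by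
    simp_rw [← sum_traceChar_mul_add_pow hv, sq, Finset.sum_mul_sum]
    rw [Finset.sum_comm]
    have e : ∀ x : K, ∑ p : K × K, ∑ y : K, traceChar K (p.1 * x + p.2 * x ^ v) *
        traceChar K (p.1 * y + p.2 * y ^ v) = (Fintype.card K : ℂ) ^ 2 := by
      intro x
      rw [Finset.sum_comm]
      have e : ∀ y : K, ∑ p : K × K, traceChar K (p.1 * x + p.2 * x ^ v) *
          traceChar K (p.1 * y + p.2 * y ^ v) =
          if y = -x then (Fintype.card K : ℂ) ^ 2 else 0 := by
        intro y
        have e : ∀ p : K × K, traceChar K (p.1 * x + p.2 * x ^ v) *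
            traceChar K (p.1 * y + p.2 * y ^ v) =
            traceChar K (p.1 * (x + y)) * traceChar K (p.2 * (x ^ v + y ^ v)) := fun p => by
          rw [← AddChar.map_add_eq_mul, ← AddChar.map_add_eq_mul]; congr 1; ring
        simp_rw [e]
        rw [Fintype.sum_prod_type]
        simp_rw [← Finset.mul_sum]
        rw [← Finset.sum_mul, sum_traceChar_mul, sum_traceChar_mul]
        by_cases hy : y = -x
        · rw [hy, hv.neg_pow]; simp [sq]
        · rw [if_neg hy, if_neg (fun h => hy (eq_neg_of_add_eq_zero_right h)), zero_mul]
      simp_rw [e]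
      simp
    simp_rw [e]
    rw [Finset.sum_const, Finset.card_univ, nsmul_eq_mul]; ring
  exact_mod_cast h

/-- The power `x ^ v` determines `x ^ (v k) = x²`, hence `x` up to sign, and oddness of `v`
separates the signs. -/
theorem pow_bijective_of_mul_modEq_two {m v k : ℕ} (hK : Fintype.card K = 3 ^ m) (hv : Odd v)
    (hk : k ≠ 0) (h : v * k ≡ 2 [MOD 3 ^ m - 1]) : Function.Bijective fun x : K => x ^ v := by
  refine Finite.injective_iff_bijective.1 fun x y hxy => ?_
  change x ^ v = y ^ v at hxy
  have hsq : x ^ 2 = y ^ 2 := by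
    rw [← pow_mul_eq_sq hK hv.pos.ne' hk h, ← pow_mul_eq_sq hK hv.pos.ne' hk h, pow_mul, hxy,
      pow_mul]
  rcases sq_eq_sq_iff_eq_or_eq_neg.1 hsq with e | e
  · exact e
  · rw [e, hv.neg_pow] at hxy
    have : (2 : K) * y ^ v = 0 := by linear_combination -hxy
    have hy := pow_eq_zero_iff hv.pos.ne' |>.1
      ((mul_eq_zero.1 this).resolve_left (two_ne_zero_of_three K))
    rw [e, hy, neg_zero]

theorem quadratic_sum_add_conj {m v k : ℕ} (hodd : Odd m) (hK : Fintype.card K = 3 ^ m)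
    (hv : Odd v) (h : v * (k + 1) ≡ 2 [MOD 3 ^ m - 1]) (σ : K ≃ₐ[ZMod 3] K)
    (hσ : ∀ x, σ x = x ^ k) (p : K × K) :
    (∑ z, traceChar K (p.1 * (z * σ z) + p.2 * z ^ 2)) +
        conj (∑ z, traceChar K (p.1 * (z * σ z) + p.2 * z ^ 2)) =
      2 * ∑ x, traceChar K (p.1 * x + p.2 * x ^ v) := by
  set P := Equiv.ofBijective _ (pow_bijective_of_mul_modEq_two hK hv k.succ_ne_zero h) with hP
  have hPσ : ∀ z, P.symm (z ^ 2) = z * σ z := by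
    intro z
    rw [Equiv.symm_apply_eq]
    change z ^ 2 = (z * σ z) ^ v
    rw [hσ, ← pow_mul_eq_sq hK hv.pos.ne' k.succ_ne_zero h, ← pow_succ', ← pow_mul, mul_comm]
  have hPneg : ∀ z, P.symm (-z ^ 2) = -(z * σ z) := by
    intro z
    rw [Equiv.symm_apply_eq]
    change -z ^ 2 = (-(z * σ z)) ^ v
    rw [hv.neg_pow, ← hPσ]
    exact congrArg Neg.neg (P.apply_symm_apply (z ^ 2)).symm
  have hmain := sum_square_add_sum_neg_square hodd hK
    (fun y => traceChar K (p.1 * P.symm y + p.2 * y))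
  simp only [hPσ, hPneg] at hmain
  rw [← Equiv.sum_comp P (fun y => traceChar K (p.1 * P.symm y + p.2 * y))] at hmain
  simp only [Equiv.symm_apply_apply] at hmain
  rw [map_sum]
  refine Eq.trans ?_ hmain
  congr 1
  refine Finset.sum_congr rfl fun z _ => ?_
  rw [← AddChar.map_neg_eq_conj]; congr 1; ring

theorem traceOneCount_three_valued {m v h : ℕ} (hodd : Odd m) (hK : Fintype.card K = 3 ^ m)
    (hv : Odd v) (hcop : Nat.Coprime h m) (hvh : v * (3 ^ h + 1) ≡ 2 [MOD 3 ^ m - 1])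
    {p : K × K} (hp : p ≠ 0) :
    (Fintype.card K : ℤ) - 3 * traceOneCount v p = 0 ∨
      (Fintype.card K : ℤ) - 3 * traceOneCount v p = 3 ^ ((m + 1) / 2) ∨
      (Fintype.card K : ℤ) - 3 * traceOneCount v p = -3 ^ ((m + 1) / 2) := by
  have : Module.Finite (ZMod 3) K := Module.Finite.of_finite
  set σ : K ≃ₐ[ZMod 3] K := FiniteField.frobeniusAlgEquivOfAlgebraic (ZMod 3) K ^ h
  have hσ : ∀ x, σ x = x ^ 3 ^ h := by
    intro x
    rw [AlgEquiv.coe_pow, FiniteField.coe_frobeniusAlgEquivOfAlgebraic_iterate, ZMod.card]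
  refine three_valued_of_quadratic hodd hK σ (fun x hx => ?_) (a := p.1) (b := p.2) hp _ ?_
  · exact pow_three_eq_self_of_frobenius_fixed hK hcop (by rw [← hσ, hx])
  · rw [quadratic_sum_add_conj hodd hK hv hvh σ hσ p, sum_traceChar_mul_add_pow hv]
    push_cast; ring

end powerSum

/-! ### Frequencies of a three-valued function -/

open Classical in
theorem three_valued_counts {X : Type*} [Fintype X] (D : X → ℤ) (x₀ : X) {q e : ℤ}
    (he : 0 < e) (heq : e < q) (h₀ : D x₀ = q)
    (hD : ∀ x, x ≠ x₀ → D x = 0 ∨ D x = e ∨ D x = -e) :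
    ∑ x, D x = q + e * (Finset.univ.filter fun x => D x = e).card
        - e * (Finset.univ.filter fun x => D x = -e).card ∧
    ∑ x, D x ^ 2 = q ^ 2 + e ^ 2 * (Finset.univ.filter fun x => D x = e).card
        + e ^ 2 * (Finset.univ.filter fun x => D x = -e).card ∧
    (Fintype.card X : ℤ) = 1 + (Finset.univ.filter fun x => D x = 0).card
        + (Finset.univ.filter fun x => D x = e).card
        + (Finset.univ.filter fun x => D x = -e).card := by
  have hind : ∀ c : ℤ, ((Finset.univ.filter fun x => D x = c).card : ℤ)
      = ∑ x, if D x = c then 1 else 0 := fun c => by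
    rw [Finset.sum_boole]
  have h1 : (1 : ℤ) = ∑ x, if x = x₀ then 1 else 0 := by simp
  have hval : ∀ x, (x = x₀ ∧ D x = q) ∨ (x ≠ x₀ ∧ (D x = 0 ∨ D x = e ∨ D x = -e)) := by
    intro x
    by_cases hx : x = x₀
    · exact Or.inl ⟨hx, hx ▸ h₀⟩
    · exact Or.inr ⟨hx, hD x hx⟩
  have c1 : e ≠ 0 := he.ne'
  have c2 : e ≠ -e := by omega
  have c3 : q ≠ e := heq.ne'
  have c4 : q ≠ -e := by omega
  have c5 : q ≠ 0 := by omega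
  have c6 : -e ≠ e := by omega
  refine ⟨?_, ?_, ?_⟩
  · rw [← mul_one q, h1, hind, hind, Finset.mul_sum, Finset.mul_sum, Finset.mul_sum,
      ← Finset.sum_add_distrib, ← Finset.sum_sub_distrib]
    refine Finset.sum_congr rfl fun x _ => ?_
    rcases hval x with ⟨hx, h⟩ | ⟨hx, h | h | h⟩ <;> rw [h] <;>
      simp [hx, c1, c2, c3, c4, c6, c1.symm]
  · rw [← mul_one (q ^ 2), h1, hind, hind, Finset.mul_sum, Finset.mul_sum, Finset.mul_sum,
      ← Finset.sum_add_distrib, ← Finset.sum_add_distrib]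
    refine Finset.sum_congr rfl fun x _ => ?_
    rcases hval x with ⟨hx, h⟩ | ⟨hx, h | h | h⟩ <;> rw [h] <;>
      simp [hx, c1, c2, c3, c4, c6, c1.symm]
  · rw [h1, hind, hind, hind, Fintype.card_eq_sum_ones]
    push_cast
    rw [← Finset.sum_add_distrib, ← Finset.sum_add_distrib, ← Finset.sum_add_distrib]
    refine Finset.sum_congr rfl fun x _ => ?_
    rcases hval x with ⟨hx, h⟩ | ⟨hx, h | h | h⟩ <;> rw [h] <;>
      simp [hx, c1, c2, c3, c4, c5, c6, c1.symm]

/-! ### The code as words of traces -/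

section code
variable {K : Type*} [Field K] [Algebra (ZMod 3) K]

/-- The word of the values `Tr (a x + b x ^ v)` at the powers `x = α ^ i`, `i < n`. -/
noncomputable def traceWord (v n : ℕ) (α : K) : (K × K) →ₗ[ZMod 3] (Fin n → ZMod 3) :=
  LinearMap.pi fun i => Algebra.trace (ZMod 3) K ∘ₗ
    LinearMap.coprod (LinearMap.mulRight (ZMod 3) (α ^ (i : ℕ)))
      (LinearMap.mulRight (ZMod 3) ((α ^ (i : ℕ)) ^ v))

theorem traceWord_apply (v n : ℕ) (α : K) (p : K × K) (i : Fin n) :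
    traceWord v n α p i =
      Algebra.trace (ZMod 3) K (p.1 * α ^ (i : ℕ) + p.2 * (α ^ (i : ℕ)) ^ v) := rfl

theorem trace_of_eq_top {F : Type*} [Field F] {K : Type*} [Field K] [Algebra F K]
    {L : IntermediateField F K} (h : L = ⊤) (x : L) :
    Algebra.trace F L x = Algebra.trace F K (x : K) := by
  subst h
  exact (Algebra.trace_eq_of_algEquiv IntermediateField.topEquiv x).symm

theorem cyclicCode_eq_range_traceWord {v m : ℕ} {α : Kˣ}
    (h1 : (ZMod 3)⟮(α : K) ^ 1⟯ = ⊤) (hv : (ZMod 3)⟮(α : K) ^ v⟯ = ⊤) :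
    cyclicCode 1 v 3 m α = LinearMap.range (traceWord v (3 ^ m - 1) (α : K)) := by
  have key : ∀ p, codewordMap 1 v 3 m α p =
      traceWord v (3 ^ m - 1) (α : K) ((p.1 : K), (p.2 : K)) := by
    intro p
    funext i
    change Algebra.trace (ZMod 3) (ZMod 3)⟮(α : K) ^ 1⟯ (p.1 * _ ^ (i : ℕ)) +
      Algebra.trace (ZMod 3) (ZMod 3)⟮(α : K) ^ v⟯ (p.2 * _ ^ (i : ℕ)) = _
    rw [trace_of_eq_top h1, trace_of_eq_top hv, traceWord_apply, ← map_add]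
    simp [IntermediateField.AdjoinSimple.coe_gen, pow_right_comm]
  ext c
  constructor
  · rintro ⟨p, rfl⟩
    exact ⟨_, (key p).symm⟩
  · rintro ⟨p, rfl⟩
    exact ⟨(⟨p.1, h1 ▸ IntermediateField.mem_top⟩, ⟨p.2, hv ▸ IntermediateField.mem_top⟩), key _⟩

theorem pow_finRotate {M : Type*} [Monoid M] {n : ℕ} {x : M} (hx : x ^ n = 1) (j : Fin n) :
    x ^ (finRotate n j : ℕ) = x ^ ((j : ℕ) + 1) := by
  rcases n with - | n
  · exact j.elim0
  rcases Nat.lt_or_ge j n with h | h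
  · rw [coe_finRotate_of_ne_last]
    exact fun e => by simp [e] at h
  · obtain rfl : j = Fin.last n := Fin.ext (by have := j.2; simp; omega)
    rw [finRotate_last, Fin.val_last, hx, Fin.val_zero, pow_zero]

theorem isCyclicCode_range_traceWord (v n : ℕ) {α : K} (h0 : α ≠ 0) (hα : α ^ n = 1) :
    IsCyclicCode (LinearMap.range (traceWord v n α)) := by
  rintro c ⟨p, rfl⟩
  -- Shifting the index back by one replaces `x` by `α⁻¹ x`; the wrap-around is harmless because `α
  -- ^ n = 1`.
  refine ⟨(p.1 * α⁻¹, p.2 * (α ^ v)⁻¹), ?_⟩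
  funext i
  obtain ⟨j, rfl⟩ := (finRotate n).surjective i
  rw [traceWord_apply, traceWord_apply, Equiv.symm_apply_apply, pow_finRotate hα]
  congr 1
  rw [pow_succ, mul_pow]
  have := pow_ne_zero v h0
  field_simp

variable [Fintype K]

theorem hammingNorm_traceWord {v n : ℕ} (hv : Odd v) {α : K} (hinj : Set.InjOn (fun i : ℕ => α ^ i)
    (Set.Iio n)) (hsurj : ∀ x : K, x ≠ 0 → ∃ i < n, α ^ i = x) (p : K × K) :
    hammingNorm (traceWord v n α p) = 2 * traceOneCount v p := by
  rw [← card_trace_ne_zero hv, hammingNorm]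
  refine Finset.card_bij (fun i _ => α ^ (i : ℕ)) ?_ ?_ ?_
  · intro i hi
    simpa [traceWord_apply] using hi
  · intro i _ j _ hij
    exact Fin.ext (hinj i.2 j.2 hij)
  · intro x hx
    have hx := (Finset.mem_filter.1 hx).2
    have hx0 : x ≠ 0 := by
      rintro rfl
      simp [hv.pos.ne'] at hx
    obtain ⟨i, hi, rfl⟩ := hsurj x hx0
    exact ⟨⟨i, hi⟩, by simpa [traceWord_apply] using hx, rfl⟩

theorem weightCount_range_traceWord {v n : ℕ} {α : K}
    (hnorm : ∀ p, hammingNorm (traceWord v n α p) = 2 * traceOneCount v p)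
    (hker : Function.Injective (traceWord v n α)) (w : ℕ) :
    weightCount (LinearMap.range (traceWord v n α)) w =
      (Finset.univ.filter fun p : K × K => 2 * traceOneCount v p = w).card := by
  rw [← Set.ncard_coe_finset, ← Set.ncard_image_of_injective _ hker, weightCount]
  congr 1
  ext c
  constructor
  · rintro ⟨⟨p, rfl⟩, hw⟩
    exact ⟨p, by simpa [hnorm] using hw, rfl⟩
  · rintro ⟨p, hp, rfl⟩
    exact ⟨⟨p, rfl⟩, by simpa [hnorm] using hp⟩

end code

/-! ### Weight distribution and conclusion -/

theorem adjoin_pow_eq_top {m u : ℕ} (hm : 0 < m) {K : Type*} [Field K] [Algebra (ZMod 3) K]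
    (hK : Nat.card K = 3 ^ m) (α : Kˣ) (hα : ∀ x : Kˣ, x ∈ Subgroup.zpowers α)
    (hu : (cyclotomicCoset 3 (3 ^ m - 1) u).ncard = m) : (ZMod 3)⟮(α : K) ^ u⟯ = ⊤ := by
  have : Finite K := Nat.finite_of_card_ne_zero (by rw [hK]; positivity)
  have : Fintype K := Fintype.ofFinite K
  have : Module.Finite (ZMod 3) K := Module.Finite.of_finite
  have hr : Module.finrank (ZMod 3) K = m := by
    have h := Module.card_eq_pow_finrank (K := ZMod 3) (V := K)
    rw [← Nat.card_eq_fintype_card, hK, ZMod.card] at h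
    exact (Nat.pow_right_injective (le_of_lt (by norm_num : 2 < 3)) h).symm
  refine IntermediateField.eq_of_le_of_finrank_eq le_top ?_
  rw [finrank_adjoin_pow 3 m u hK hm α hα, hu, IntermediateField.finrank_top', hr]

theorem weight_distribution {t v h : ℕ} (ht : 1 ≤ t) {K : Type*} [Field K] [Fintype K]
    [Algebra (ZMod 3) K] (hK : Fintype.card K = 3 ^ (2 * t + 1)) (hv : Odd v)
    (hcop : Nat.Coprime h (2 * t + 1))
    (hvh : v * (3 ^ h + 1) ≡ 2 [MOD 3 ^ (2 * t + 1) - 1]) :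
    (∀ p : K × K, traceOneCount v p = 0 → p = 0) ∧
    2 * ((Finset.univ.filter fun p : K × K =>
      2 * traceOneCount v p = 2 * (3 ^ (2 * t) - 3 ^ t)).card : ℤ) =
        (3 ^ (2 * t + 1) - 1) * (3 ^ (2 * t) + 3 ^ t) ∧
    ((Finset.univ.filter fun p : K × K => 2 * traceOneCount v p = 2 * 3 ^ (2 * t)).card : ℤ) =
        (3 ^ (2 * t + 1) - 1) * (3 ^ (2 * t + 1) - 3 ^ (2 * t) + 1) ∧
    2 * ((Finset.univ.filter fun p : K × K =>
      2 * traceOneCount v p = 2 * (3 ^ (2 * t) + 3 ^ t)).card : ℤ) =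
        (3 ^ (2 * t + 1) - 1) * (3 ^ (2 * t) - 3 ^ t) ∧
    ∀ p : K × K, traceOneCount v p = 0 ∨ traceOneCount v p = 3 ^ (2 * t) - 3 ^ t ∨
      traceOneCount v p = 3 ^ (2 * t) ∨ traceOneCount v p = 3 ^ (2 * t) + 3 ^ t := by
  classical
  have hvals : ∀ p : K × K, p ≠ 0 → _ := fun p hp =>
    traceOneCount_three_valued ⟨t, rfl⟩ hK hv hcop hvh hp
  have hm1 := first_moment (K := K) hv
  have hm2 := second_moment (K := K) hv
  have hcardX : Fintype.card (K × K) = Fintype.card K ^ 2 := by rw [Fintype.card_prod, sq]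
  have hzero : traceOneCount v (0 : K × K) = 0 := by simp [traceOneCount, valueCount]
  have hr : 3 ≤ 3 ^ t := by
    calc 3 = 3 ^ 1 := rfl
      _ ≤ 3 ^ t := Nat.pow_le_pow_right (by norm_num) ht
  have eexp : (2 * t + 1 + 1) / 2 = t + 1 := by omega
  have p1 : 3 ^ (2 * t + 1) = 3 * (3 ^ t * 3 ^ t) := by ring
  have p2 : 3 ^ (2 * t) = 3 ^ t * 3 ^ t := by ring
  have p1' : (3 : ℤ) ^ (2 * t + 1) = 3 * (3 ^ t * 3 ^ t) := by ring
  have p2' : (3 : ℤ) ^ (2 * t) = 3 ^ t * 3 ^ t := by ring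
  rw [eexp, pow_succ, hK, p1] at hvals
  rw [hK, p1] at hm1 hm2 hcardX
  rw [p1', p2', p2]
  -- From here everything is polynomial in `r = 3 ^ t`: `q = 3 r²`, and the nonzero values of `T`
  -- for `p ≠ 0` are `± 3 r`.
  generalize hR : 3 ^ t = r at *
  have hR' : (3 : ℤ) ^ t = (r : ℤ) := by rw [← hR]; norm_cast
  push_cast at hvals hm1 hm2
  simp only [hR'] at hvals ⊢
  have hrz : (3 : ℤ) ≤ r := by exact_mod_cast hr
  have hle : r ≤ r * r := by nlinarith
  -- A zero count means `T = q`, which is none of `0, ± 3 r` since `r ≥ 3`; this later gives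
  -- injectivity and hence dimension `2 m`.
  have hval0 : ∀ p : K × K, traceOneCount v p = 0 → p = 0 := by
    intro p hp
    by_contra hne
    have := hvals p hne
    rw [hp] at this
    push_cast at this
    rcases this with h | h | h <;> nlinarith
  obtain ⟨c1, c2, c3⟩ := three_valued_counts
    (fun p : K × K => 3 * ((r : ℤ) * r) - 3 * traceOneCount v p) 0 (q := 3 * ((r : ℤ) * r))
    (e := r * 3) (by linarith) (by nlinarith) (by rw [hzero]; simp) hvals
  rw [hm1] at c1
  rw [hm2] at c2
  rw [hcardX] at c3
  push_cast at c3
  have f0 : (Finset.univ.filter fun p : K × K => 2 * traceOneCount v p = 2 * (r * r)) =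
      Finset.univ.filter fun p : K × K => 3 * ((r : ℤ) * r) - 3 * traceOneCount v p = 0 := by
    refine Finset.filter_congr fun p _ => ?_
    zify; constructor <;> intro h <;> linarith
  have f1 : (Finset.univ.filter fun p : K × K => 2 * traceOneCount v p = 2 * (r * r - r)) =
      Finset.univ.filter fun p : K × K => 3 * ((r : ℤ) * r) - 3 * traceOneCount v p = r * 3 := by
    refine Finset.filter_congr fun p _ => ?_
    zify [hle]; constructor <;> intro h <;> linarith
  have f2 : (Finset.univ.filter fun p : K × K => 2 * traceOneCount v p = 2 * (r * r + r)) =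
      Finset.univ.filter fun p : K × K =>
        3 * ((r : ℤ) * r) - 3 * traceOneCount v p = -(r * 3) := by
    refine Finset.filter_congr fun p _ => ?_
    zify; constructor <;> intro h <;> linarith
  rw [f0, f1, f2]
  set N₀ := ((Finset.univ.filter fun p : K × K =>
    3 * ((r : ℤ) * r) - 3 * traceOneCount v p = 0).card : ℤ)
  set N₁ := ((Finset.univ.filter fun p : K × K =>
    3 * ((r : ℤ) * r) - 3 * traceOneCount v p = r * 3).card : ℤ)
  set N₂ := ((Finset.univ.filter fun p : K × K =>
    3 * ((r : ℤ) * r) - 3 * traceOneCount v p = -(r * 3)).card : ℤ)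
  have hr0 : (r : ℤ) * 3 ≠ 0 := by positivity
  have d1 : N₁ - N₂ = r * (3 * (r * r) - 1) := by
    refine mul_left_cancel₀ hr0 ?_
    linear_combination -c1
  have d2 : N₁ + N₂ = r * r * (3 * (r * r) - 1) := by
    refine mul_left_cancel₀ (pow_ne_zero 2 hr0) ?_
    linear_combination -c2
  refine ⟨hval0, by linear_combination d1 + d2, by linear_combination -c3 - d2,
    by linear_combination d2 - d1, fun p => ?_⟩
  by_cases hp : p = 0
  · left; rw [hp, hzero]
  right
  rcases hvals p hp with h | h | h
  · right; left; zify; linarith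
  · left; zify [hle]; linarith
  · right; right; zify; linarith

theorem theorem5 (m : ℕ) (hm : 3 ≤ m) (hodd : Odd m)
    (K : Type*) [Field K] [Algebra (ZMod 3) K] (hK : Nat.card K = 3 ^ m)
    (α : Kˣ) (hα : ∀ x : Kˣ, x ∈ Subgroup.zpowers α)
    (v : ℕ)
    (hv : (∃ h : ℕ, 0 < h ∧ h ∣ m + 1 ∧ Even ((m + 1) / h) ∧
            v = (3 ^ (m + 1) - 1) / (3 ^ h + 1) + (3 ^ m - 1) / 2) ∨
          (m % 8 = 7 ∧
            v = (3 ^ ((m + 1) / 8) - 1) * (3 ^ ((m + 1) / 4) + 1) * (3 ^ ((m + 1) / 2) + 1)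
                  + (3 ^ m - 1) / 2) ∨
          (m % 4 = 3 ∧
            v = (3 ^ ((m + 1) / 4) - 1) * (3 ^ ((m + 1) / 2) + 1) + (3 ^ m - 1) / 2)) :
    -- the two cyclotomic cosets are disjoint and have size `m`
    Disjoint (cyclotomicCoset 3 (3 ^ m - 1) 1) (cyclotomicCoset 3 (3 ^ m - 1) v) ∧
    (cyclotomicCoset 3 (3 ^ m - 1) 1).ncard = m ∧
    (cyclotomicCoset 3 (3 ^ m - 1) v).ncard = m ∧
    -- a cyclic code of length `3 ^ m - 1` and dimension `2 m`
    IsCyclicCode (cyclicCode 1 v 3 m α) ∧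
    Module.finrank (ZMod 3) (cyclicCode 1 v 3 m α) = 2 * m ∧
    -- its weight distribution
    weightCount (cyclicCode 1 v 3 m α) 0 = 1 ∧
    (weightCount (cyclicCode 1 v 3 m α) (2 * (3 ^ (m - 1) - 3 ^ ((m - 1) / 2))) : ℚ) =
      1 / 2 * (3 ^ m - 1) * (3 ^ (m - 1) + 3 ^ ((m - 1) / 2)) ∧
    (weightCount (cyclicCode 1 v 3 m α) (2 * 3 ^ (m - 1)) : ℚ) =
      (3 ^ m - 1) * (3 ^ m - 3 ^ (m - 1) + 1) ∧
    (weightCount (cyclicCode 1 v 3 m α) (2 * (3 ^ (m - 1) + 3 ^ ((m - 1) / 2))) : ℚ) =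
      1 / 2 * (3 ^ m - 1) * (3 ^ (m - 1) - 3 ^ ((m - 1) / 2)) ∧
    (∀ w : ℕ, w ≠ 0 → w ≠ 2 * (3 ^ (m - 1) - 3 ^ ((m - 1) / 2)) → w ≠ 2 * 3 ^ (m - 1) →
      w ≠ 2 * (3 ^ (m - 1) + 3 ^ ((m - 1) / 2)) →
      weightCount (cyclicCode 1 v 3 m α) w = 0) := by
  obtain ⟨hvodd, h, h0, hlt, hcop, hmod⟩ := exists_exponent hm hodd hv
  classical
  have : Finite K := Nat.finite_of_card_ne_zero (by rw [hK]; positivity)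
  have : Fintype K := Fintype.ofFinite K
  have hKf : Fintype.card K = 3 ^ m := by rw [← Nat.card_eq_fintype_card, hK]
  have hz : (v : ZMod (3 ^ m - 1)) * (3 ^ h + 1 : ℕ) = 2 := by
    exact_mod_cast (ZMod.natCast_eq_natCast_iff _ _ _).2 hmod
  have hC1 : (cyclotomicCoset 3 (3 ^ m - 1) 1).ncard = m :=
    ncard_cyclotomicCoset_of_mul_eq_two (c := 2) (by omega) (by simp)
  have hCv : (cyclotomicCoset 3 (3 ^ m - 1) v).ncard = m :=
    ncard_cyclotomicCoset_of_mul_eq_two (by omega) hz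
  have hcode := cyclicCode_eq_range_traceWord (m := m)
    (adjoin_pow_eq_top (by omega) hK α hα hC1) (adjoin_pow_eq_top (by omega) hK α hα hCv)
  have hord : orderOf α = 3 ^ m - 1 := by
    rw [orderOf_eq_card_of_forall_mem_zpowers hα, Nat.card_units, hK]
  have hαpow : (α : K) ^ (3 ^ m - 1) = 1 := by
    rw [← hord, ← Units.val_pow_eq_pow_val, pow_orderOf_eq_one, Units.val_one]
  have hinj : Set.InjOn (fun i : ℕ => (α : K) ^ i) (Set.Iio (3 ^ m - 1)) := by
    intro i hi j hj hij
    rw [← hord] at hi hj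
    exact pow_injOn_Iio_orderOf hi hj (Units.ext (by simpa using hij))
  have hsurj : ∀ x : K, x ≠ 0 → ∃ i < 3 ^ m - 1, (α : K) ^ i = x := by
    intro x hx
    obtain ⟨i, hi, e⟩ := (mem_zpowers_iff_mem_range_orderOf.trans Finset.mem_image).1
      (hα (Units.mk0 x hx))
    refine ⟨i, by simpa [hord] using hi, ?_⟩
    simpa using congrArg Units.val e
  have hnorm := hammingNorm_traceWord hvodd hinj hsurj
  obtain ⟨t, rfl⟩ := hodd
  obtain ⟨hker, w1, w2, w3, wall⟩ := weight_distribution (by omega) hKf hvodd hcop hmod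
  have hinjW : Function.Injective (traceWord v (3 ^ (2 * t + 1) - 1) (α : K)) := by
    refine (injective_iff_map_eq_zero _).2 fun p hp => hker p ?_
    have := hnorm p
    rw [hp, hammingNorm_zero] at this
    omega
  have hW := weightCount_range_traceWord hnorm hinjW
  rw [hcode]
  simp only [Nat.add_sub_cancel, Nat.mul_div_cancel_left t two_pos]
  refine ⟨disjoint_cyclotomicCoset (by omega) h0 hlt hz, hC1, hCv,
    isCyclicCode_range_traceWord v _ α.ne_zero hαpow, ?_, ?_, ?_, ?_, ?_, ?_⟩
  · have hr : Module.finrank (ZMod 3) K = 2 * t + 1 := by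
      have h := Module.card_eq_pow_finrank (K := ZMod 3) (V := K)
      rw [hKf, ZMod.card] at h
      exact (Nat.pow_right_injective (le_of_lt (by norm_num : 2 < 3)) h).symm
    have : Module.Finite (ZMod 3) K := Module.Finite.of_finite
    rw [LinearMap.finrank_range_of_inj hinjW, Module.finrank_prod, hr]; ring
  · rw [hW, Finset.card_eq_one]
    refine ⟨0, ?_⟩
    ext p
    simp only [Finset.mem_filter, Finset.mem_univ, true_and, Finset.mem_singleton]
    refine ⟨fun hp => hker p (by omega), ?_⟩
    rintro rfl
    rw [← hnorm, map_zero, hammingNorm_zero]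
  · rw [hW]
    have := congrArg (fun n : ℤ => (n : ℚ)) w1
    push_cast at this
    linear_combination this / 2
  · rw [hW]
    exact_mod_cast w2
  · rw [hW]
    have := congrArg (fun n : ℤ => (n : ℚ)) w3
    push_cast at this
    linear_combination this / 2
  · intro w n0 n1 n2 n3
    rw [hW, Finset.card_eq_zero, Finset.filter_eq_empty_iff]
    rintro p - rfl
    rcases wall p with h | h | h | h <;> rw [h] at n0 n1 n2 n3 <;> simp at n0 n1 n2 n3
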